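/- Let $\mathcal H_S=L^2(\mathbb R^d)$ (the system), $\mathcal H_E=L^2(\mathbb R^N)$ (the environment), and let $\mathcal H=\mathcal H_S\otimes\mathcal H_E$ be their Hilbert tensor product. Write $z=(x,\xi)\in\mathbb R^{2d}$ and $u=(y,\eta)\in\mathbb R^{2N}$ for the phase space variables, and let $$\hat H=\hat H_S\otimes\mathbb I+\mathbb I\otimes\hat H_E+\hat V,$$ where $\hat H_S$, $\hat H_E$, $\hat V$ are the Weyl quantizations (with $\hbar=1$) of the real quadratic forms $\tfrac12 z\cdot A_Sz$, $\tfrac12 u\cdot A_Eu$ and of the bilinear coupling $z\cdot Gu$, with real matrices $A_S$, $A_E$, $G$ that may depend on time. Let $U(t)$, $t\in\mathbb R$, be the unitary propagator: $i\,\partial_tU(t)=\hat H(t)U(t)$ (weakly, against tensor products of Schwartz functions) and $U(0)=\mathbb I$; so $U(t)=e^{-it\hat H}$ if $\hat H$ does not depend on time. (If the coefficients depend on time, it is assumed that such a propagator exists.) Let $\hat\rho_S(0)$ and $\hat\rho_E(0)$ be pure Gaussian states on $\mathcal H_S$ and $\mathcal H_E$: orthogonal projectors on unit vectors whose Wigner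 functions have the form $\det(\Gamma)^{-1/2}\exp(-\tfrac12(w-m)\cdot\Gamma^{-1}(w-m))$ with a positive definite covariance matrix $\Gamma$ and a mean vector $m$. Put $$\hat\rho(t)=U(t)\bigl(\hat\rho_S(0)\otimes\hat\rho_E(0)\bigr)U(t)^*,\qquad \hat\rho_S(t)=\mathrm{tr}_E\,\hat\rho(t),\qquad \hat\rho_E(t)=\mathrm{tr}_S\,\hat\rho(t),$$ where $\mathrm{tr}_E$, $\mathrm{tr}_S$ are the partial traces, and let $p_{ur}(t)=\mathrm{tr}_S\bigl(\hat\rho_S(t)^2\bigr)$ be the purity of the system. If $\ddot p_{ur}(0)$ exists and $\ddot p_{ur}(0)\neq0$, then there is $\varepsilon>0$ such that $$\hat\rho(t)\neq\hat\rho_S(t)\otimes\hat\rho_E(t)\qquad\text{for every } t\in(0,\varepsilon].$$ -/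

import Mathlib

open MeasureTheory TensorProduct
open scoped SchwartzMap InnerProductSpace Matrix

noncomputable section

/-! ## Traces, Hilbert tensor products, partial traces -/

section General

variable {H : Type*} [NormedAddCommGroup H] [InnerProductSpace ℂ H] [CompleteSpace H]
variable {E : Type*} [NormedAddCommGroup E] [InnerProductSpace ℂ E] [CompleteSpace E]
variable {F : Type*} [NormedAddCommGroup F] [InnerProductSpace ℂ F] [CompleteSpace F]

/-- The index set of a chosen Hilbert (orthonormal) basis of `H`. -/
def someBasisIndex (H : Type*) [NormedAddCommGroup H] [InnerProductSpace ℂ H]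
    [CompleteSpace H] : Set H :=
  Classical.choose (exists_hilbertBasis ℂ H)

/-- A chosen Hilbert (orthonormal) basis of `H`. -/
def someBasis (H : Type*) [NormedAddCommGroup H] [InnerProductSpace ℂ H]
    [CompleteSpace H] : HilbertBasis (someBasisIndex H) ℂ H :=
  Classical.choose (Classical.choose_spec (exists_hilbertBasis ℂ H))

/-- The trace `∑ᵢ ⟨eᵢ, A eᵢ⟩` of an operator. For trace class `A` the sum converges absolutely
and does not depend on the orthonormal basis. -/
def opTrace (A : H →L[ℂ] H) : ℂ :=
  ∑' i, ⟪someBasis H i, A (someBasis H i)⟫_ℂ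

/-- The purity `tr (ρ²)` of a density operator. -/
def opPurity (ρ : H →L[ℂ] H) : ℝ := (opTrace (ρ ∘L ρ)).re

/-- The orthogonal projector `η ↦ ⟨ψ, η⟩ ψ` attached to a unit vector `ψ`. -/
def pureState (ψ : H) : H →L[ℂ] H := InnerProductSpace.rankOne ℂ ψ ψ

/-- The Hilbert tensor product: the completion of the algebraic tensor product. -/
abbrev HilbertTensor (E F : Type*) [NormedAddCommGroup E] [InnerProductSpace ℂ E]
    [NormedAddCommGroup F] [InnerProductSpace ℂ F] : Type _ :=
  UniformSpace.Completion (E ⊗[ℂ] F)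

/-- The tensor product `A ⊗ B` of two bounded operators, on the Hilbert tensor product. -/
def opTensor (A : E →L[ℂ] E) (B : F →L[ℂ] F) : HilbertTensor E F →L[ℂ] HilbertTensor E F :=
  (TensorProduct.mapL A B).completion

/-- The bounded operator `e ↦ e ⊗ f`. -/
def tensorWith (E : Type*) [NormedAddCommGroup E] [InnerProductSpace ℂ E] (f : F) :
    E →L[ℂ] HilbertTensor E F :=
  UniformSpace.Completion.toComplL ∘L (TensorProduct.mkL ℂ E F).flip f

/-- The bounded operator `f ↦ e ⊗ f`. -/
def withTensor (F : Type*) [NormedAddCommGroup F] [InnerProductSpace ℂ F] (e : E) :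
    F →L[ℂ] HilbertTensor E F :=
  UniformSpace.Completion.toComplL ∘L TensorProduct.mkL ℂ E F e

/-- The partial trace over the second factor: the operator on `E` with matrix elements
`⟨φ, (tr₂ A) φ'⟩ = ∑ⱼ ⟨φ ⊗ fⱼ, A (φ' ⊗ fⱼ)⟩`, for an orthonormal basis `fⱼ` of `F`.
For trace class `A` the series of operators converges absolutely in norm, does not depend
on the basis, and its sum is the only trace class operator `R` on `E` with
`tr (R B) = tr (A (B ⊗ 1))` for all bounded `B`. -/
def partialTraceSnd (A : HilbertTensor E F →L[ℂ] HilbertTensor E F) : E →L[ℂ] E :=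
  ∑' j, ContinuousLinearMap.adjoint (tensorWith E (someBasis F j)) ∘L A ∘L tensorWith E (someBasis F j)

/-- The partial trace over the first factor, defined in the same way. -/
def partialTraceFst (A : HilbertTensor E F →L[ℂ] HilbertTensor E F) : F →L[ℂ] F :=
  ∑' i, ContinuousLinearMap.adjoint (withTensor F (someBasis E i)) ∘L A ∘L withTensor F (someBasis E i)

/-- The evolved state `ρ(t) = U(t) ρ(0) U(t)*`. -/
def evolve (U : ℝ → H →L[ℂ] H) (ρ₀ : H →L[ℂ] H) (t : ℝ) : H →L[ℂ] H :=
  U t ∘L ρ₀ ∘L ContinuousLinearMap.adjoint (U t)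

end General

theorem opTensor_tmul {E F : Type*} [NormedAddCommGroup E] [InnerProductSpace ℂ E]
    [NormedAddCommGroup F] [InnerProductSpace ℂ F]
    (A : E →L[ℂ] E) (B : F →L[ℂ] F) (e : E) (f : F) :
    opTensor A B ((e ⊗ₜ[ℂ] f : E ⊗[ℂ] F) : HilbertTensor E F) =
      ((A e ⊗ₜ[ℂ] B f : E ⊗[ℂ] F) : HilbertTensor E F) := by
  simp [opTensor]

/-! ## Weyl quantization of quadratic Hamiltonians -/

/-- The configuration space `ℝⁿ`. -/
abbrev Config (n : ℕ) : Type := EuclideanSpace ℝ (Fin n)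

/-- The Hilbert space `L²(ℝⁿ)`. -/
abbrev L2 (n : ℕ) : Type := Lp ℂ 2 (volume : Measure (Config n))

/-- Indices of the coordinates `z = (x, ξ)` of the phase space `ℝ²ⁿ`: `Sum.inl j` stands for
`x_j` and `Sum.inr j` for `ξ_j`. -/
abbrev PhaseIdx (n : ℕ) : Type := Fin n ⊕ Fin n

/-- Multiplication by the coordinate `x_j`, on Schwartz functions. -/
def positionOp (n : ℕ) (j : Fin n) : 𝓢(Config n, ℂ) →ₗ[ℂ] 𝓢(Config n, ℂ) :=
  (SchwartzMap.smulLeftCLM ℂ (fun x : Config n => ((x j : ℝ) : ℂ))).toLinearMap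

theorem hasTemperateGrowth_coord (n : ℕ) (j : Fin n) :
    (fun x : Config n => ((x j : ℝ) : ℂ)).HasTemperateGrowth :=
  (Complex.ofRealCLM ∘L EuclideanSpace.proj (𝕜 := ℝ) j).hasTemperateGrowth

theorem positionOp_apply (n : ℕ) (j : Fin n) (f : 𝓢(Config n, ℂ)) (x : Config n) :
    positionOp n j f x = (x j : ℂ) * f x := by
  simp [positionOp, SchwartzMap.smulLeftCLM_apply_apply (hasTemperateGrowth_coord n j)]

/-- The momentum operator `-i ∂/∂x_j`, on Schwartz functions. -/
def momentumOp (n : ℕ) (j : Fin n) : 𝓢(Config n, ℂ) →ₗ[ℂ] 𝓢(Config n, ℂ) :=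
  (-Complex.I) • (LineDeriv.lineDerivOpCLM ℂ 𝓢(Config n, ℂ)
    (EuclideanSpace.single j (1 : ℝ) : Config n)).toLinearMap

theorem momentumOp_apply (n : ℕ) (j : Fin n) (f : 𝓢(Config n, ℂ)) (x : Config n) :
    momentumOp n j f x =
      -Complex.I * lineDeriv ℝ f x (EuclideanSpace.single j (1 : ℝ)) := by
  simp [momentumOp, SchwartzMap.lineDerivOp_apply]

/-- The Weyl quantization of the phase space coordinate `z_i`. -/
def coordOp (n : ℕ) : PhaseIdx n → 𝓢(Config n, ℂ) →ₗ[ℂ] 𝓢(Config n, ℂ) :=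
  Sum.elim (positionOp n) (momentumOp n)

/-- The Weyl quantization of the quadratic form `½ z · A z = ½ ∑ A_ij z_i z_j`; the monomial
`z_i z_j` is quantized as the symmetrized product of the operators attached to `z_i`, `z_j`. -/
def weylQuadratic {n : ℕ} (A : Matrix (PhaseIdx n) (PhaseIdx n) ℝ) :
    𝓢(Config n, ℂ) →ₗ[ℂ] 𝓢(Config n, ℂ) :=
  (1 / 2 : ℂ) • ∑ i, ∑ j, (A i j : ℂ) •
    ((1 / 2 : ℂ) • (coordOp n i ∘ₗ coordOp n j + coordOp n j ∘ₗ coordOp n i))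

/-- The total Hamiltonian `H_S ⊗ 1 + 1 ⊗ H_E + V` of a system and its environment, where `H_S`,
`H_E` and `V` are the Weyl quantizations of `½ z · A_S z`, `½ u · A_E u` and of the bilinear
coupling `z · G u`, on the algebraic tensor product of the Schwartz spaces. -/
def totalHamiltonian {d N : ℕ} (A_S : Matrix (PhaseIdx d) (PhaseIdx d) ℝ)
    (A_E : Matrix (PhaseIdx N) (PhaseIdx N) ℝ) (G : Matrix (PhaseIdx d) (PhaseIdx N) ℝ) :
    (𝓢(Config d, ℂ) ⊗[ℂ] 𝓢(Config N, ℂ)) →ₗ[ℂ] (𝓢(Config d, ℂ) ⊗[ℂ] 𝓢(Config N, ℂ)) :=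
  TensorProduct.map (weylQuadratic A_S) LinearMap.id
    + TensorProduct.map LinearMap.id (weylQuadratic A_E)
    + ∑ i, ∑ j, (G i j : ℂ) • TensorProduct.map (coordOp d i) (coordOp N j)

/-- The inclusion of the algebraic tensor product of the Schwartz spaces in the Hilbert tensor
product `L²(ℝᵈ) ⊗ L²(ℝᴺ)`. -/
def schwartzIncl (d N : ℕ) :
    (𝓢(Config d, ℂ) ⊗[ℂ] 𝓢(Config N, ℂ)) →ₗ[ℂ] HilbertTensor (L2 d) (L2 N) :=
  (UniformSpace.Completion.toComplL (𝕜 := ℂ) (E := L2 d ⊗[ℂ] L2 N)).toLinearMap ∘ₗ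
    TensorProduct.map
      (SchwartzMap.toLpCLM ℂ ℂ 2 (volume : Measure (Config d))).toLinearMap
      (SchwartzMap.toLpCLM ℂ ℂ 2 (volume : Measure (Config N))).toLinearMap

/-- `U` is the quantum propagator of the (possibly time dependent) Hamiltonian `h`: the `U t` are
unitary, `U 0 = 1`, and `i dU/dt = h(t) U` holds weakly, that is against the test vectors in the
algebraic tensor product of the Schwartz spaces. If `h` is a constant quadratic Hamiltonian, this
says `U t = exp (-i t h)`, because `h` is then essentially self-adjoint on these vectors. -/
structure IsPropagator {d N : ℕ}
    (h : ℝ → (𝓢(Config d, ℂ) ⊗[ℂ] 𝓢(Config N, ℂ)) →ₗ[ℂ] (𝓢(Config d, ℂ) ⊗[ℂ] 𝓢(Config N, ℂ)))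
    (U : ℝ → HilbertTensor (L2 d) (L2 N) →L[ℂ] HilbertTensor (L2 d) (L2 N)) : Prop where
  unitary : ∀ t, U t ∈ unitary (HilbertTensor (L2 d) (L2 N) →L[ℂ] HilbertTensor (L2 d) (L2 N))
  zero : U 0 = 1
  schrodinger : ∀ (Φ : 𝓢(Config d, ℂ) ⊗[ℂ] 𝓢(Config N, ℂ)) (Ψ : HilbertTensor (L2 d) (L2 N))
    (t : ℝ), HasDerivAt (fun s => ⟪schwartzIncl d N Φ, U s Ψ⟫_ℂ)
      (-Complex.I * ⟪schwartzIncl d N (h t Φ), U t Ψ⟫_ℂ) t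

/-! ## Gaussian pure states -/

/-- The Wigner function of `ψ`, which is the Weyl symbol of the projector on `ψ`:
`W(x, ξ) = ∫ exp (-i ξ · y) ψ(x + y/2) conj (ψ(x - y/2)) dy`. -/
def wigner {n : ℕ} (ψ : L2 n) (z : PhaseIdx n → ℝ) : ℂ :=
  ∫ y : Config n, Complex.exp (-Complex.I * ((∑ j, z (Sum.inr j) * y j : ℝ) : ℂ)) *
    ψ (WithLp.toLp 2 (fun j => z (Sum.inl j)) + (1 / 2 : ℝ) • y) *
    (starRingEnd ℂ) (ψ (WithLp.toLp 2 (fun j => z (Sum.inl j)) - (1 / 2 : ℝ) • y))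

/-- The Gaussian symbol with mean `m` and covariance matrix `Γ`:
`det(Γ)^(-1/2) exp (-½ (z - m) · Γ⁻¹ (z - m))`. -/
def gaussianSymbol {n : ℕ} (Γ : Matrix (PhaseIdx n) (PhaseIdx n) ℝ) (m z : PhaseIdx n → ℝ) : ℝ :=
  (Real.sqrt Γ.det)⁻¹ * Real.exp (-(1 / 2) * ((z - m) ⬝ᵥ (Γ⁻¹ *ᵥ (z - m))))

/-- A pure Gaussian state on `L²(ℝⁿ)`: the projector on a unit vector `ψ`, whose Weyl symbol is
Gaussian with a positive definite covariance matrix. -/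
def IsGaussianPureState {n : ℕ} (ρ : L2 n →L[ℂ] L2 n) : Prop :=
  ∃ ψ : L2 n, ‖ψ‖ = 1 ∧ ρ = pureState ψ ∧
    ∃ (Γ : Matrix (PhaseIdx n) (PhaseIdx n) ℝ) (m : PhaseIdx n → ℝ), Γ.PosDef ∧
      ∀ z, wigner ψ z = (gaussianSymbol Γ m z : ℂ)

end

/-! The evolved state is the projector on the unit vector `Ψ = U t (ψ ⊗ φ)`, so everything reduces
to the purity of its partial trace. This purity is at most one
(`opPurity_partialTraceSnd_pureState_le_one`). It equals one whenever the projector is any product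
operator, because `Ψ` is then a product vector
(`opPurity_partialTraceSnd_of_pureState_eq_opTensor`).

Hence every time at which the state factorizes is a global maximum of the purity, and the first
derivative vanishes there. A nonzero second derivative at `0` keeps the first derivative away from
zero at nearby times `t ≠ 0`, which excludes factorization. No Taylor expansion is needed. -/

open Filter Topology InnerProductSpace

/-! ### Product vectors and product operators -/

section Tensor

variable {E : Type*} [NormedAddCommGroup E] [InnerProductSpace ℂ E]
variable {F : Type*} [NormedAddCommGroup F] [InnerProductSpace ℂ F]

/-- The product vector `e ⊗ f` in the Hilbert tensor product. -/
noncomputable def productVector (e : E) (f : F) : HilbertTensor E F :=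
  ((e ⊗ₜ[ℂ] f : E ⊗[ℂ] F) : HilbertTensor E F)

theorem inner_productVector (e e' : E) (f f' : F) :
    ⟪productVector e f, productVector e' f'⟫_ℂ = ⟪e, e'⟫_ℂ * ⟪f, f'⟫_ℂ := by
  simp [productVector, UniformSpace.Completion.inner_coe]

theorem norm_productVector (e : E) (f : F) : ‖productVector e f‖ = ‖e‖ * ‖f‖ := by
  simp [productVector, UniformSpace.Completion.norm_coe]

theorem productVector_smul_smul (c c' : ℂ) (e : E) (f : F) :
    productVector (c • e) (c' • f) = (c * c') • productVector e f := by
  simp only [productVector, TensorProduct.smul_tmul_smul, UniformSpace.Completion.coe_smul]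

theorem ext_productVector {X : Type*} [NormedAddCommGroup X] [NormedSpace ℂ X]
    {A B : HilbertTensor E F →L[ℂ] X}
    (h : ∀ e f, A (productVector e f) = B (productVector e f)) : A = B := by
  ext x
  refine UniformSpace.Completion.induction_on x
    (isClosed_eq A.continuous B.continuous) fun y => ?_
  induction y using TensorProduct.induction_on with
  | zero => simp [UniformSpace.Completion.coe_zero]
  | tmul e f => exact h e f
  | add a b ha hb => simp only [UniformSpace.Completion.coe_add, map_add, ha, hb]

theorem opTensor_productVector (A : E →L[ℂ] E) (B : F →L[ℂ] F) (e : E) (f : F) :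
    opTensor A B (productVector e f) = productVector (A e) (B f) :=
  opTensor_tmul A B e f

theorem opTensor_pureState (ψ : E) (φ : F) :
    opTensor (pureState ψ) (pureState φ) = pureState (productVector ψ φ) := by
  refine ext_productVector fun e f => ?_
  rw [opTensor_productVector]
  simp only [pureState, rankOne_apply, productVector_smul_smul, inner_productVector]

theorem tensorWith_apply (e : E) (f : F) : tensorWith E f e = productVector e f := rfl

/-- A unit vector whose projector is a product operator is a product of unit vectors. -/
theorem exists_productVector_of_pureState_eq_opTensor {Ψ : HilbertTensor E F} (hΨ : ‖Ψ‖ = 1)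
    {A : E →L[ℂ] E} {B : F →L[ℂ] F} (h : pureState Ψ = opTensor A B) :
    ∃ (a : E) (b : F), ‖a‖ = 1 ∧ ‖b‖ = 1 ∧ Ψ = productVector a b := by
  -- Product vectors span a dense subspace, so a nonzero vector cannot be orthogonal to all of them.
  obtain ⟨e, f, hef⟩ : ∃ e f, ⟪Ψ, productVector e f⟫_ℂ ≠ 0 := by
    by_contra! hc
    have h0 : innerSL ℂ Ψ = (0 : HilbertTensor E F →L[ℂ] ℂ) :=
      ext_productVector fun e f => by simpa using hc e f
    have : ‖innerSL ℂ Ψ‖ = 1 := by rw [innerSL_apply_norm, hΨ]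
    rw [h0, norm_zero] at this
    exact zero_ne_one this
  set c := ⟪Ψ, productVector e f⟫_ℂ with hc
  -- Both sides of `h` at `e ⊗ f` give `c Ψ = A e ⊗ B f`.
  have hP : Ψ = productVector (c⁻¹ • A e) (B f) := by
    have h1 := congrArg (fun T => T (productVector e f)) h
    simp only [opTensor_productVector, pureState, rankOne_apply] at h1
    rw [← hc] at h1
    have h2 := productVector_smul_smul c⁻¹ 1 (A e) (B f)
    rw [one_smul, mul_one] at h2
    rw [h2, ← h1, smul_smul, inv_mul_cancel₀ hef, one_smul]
  generalize c⁻¹ • A e = a at hP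
  generalize B f = b at hP
  have hn : ‖a‖ * ‖b‖ = 1 := by rw [← norm_productVector, ← hP, hΨ]
  have hb : ‖b‖ ≠ 0 := right_ne_zero_of_mul_eq_one hn
  refine ⟨(‖b‖ : ℂ) • a, (‖b‖ : ℂ)⁻¹ • b, ?_, ?_, ?_⟩
  · rw [norm_smul, Complex.norm_real, norm_norm, mul_comm, hn]
  · rw [norm_smul, norm_inv, Complex.norm_real, norm_norm, inv_mul_cancel₀ hb]
  · rw [productVector_smul_smul, mul_inv_cancel₀ (by exact_mod_cast hb), one_smul, hP]

end Tensor

/-! ### Purity of partial traces -/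

section Trace

variable {H : Type*} [NormedAddCommGroup H] [InnerProductSpace ℂ H] [CompleteSpace H]
variable {E : Type*} [NormedAddCommGroup E] [InnerProductSpace ℂ E] [CompleteSpace E]
variable {F : Type*} [NormedAddCommGroup F] [InnerProductSpace ℂ F] [CompleteSpace F]

theorem evolve_pureState (U : ℝ → H →L[ℂ] H) (ψ : H) (t : ℝ) :
    evolve U (pureState ψ) t = pureState (U t ψ) := by
  ext x
  simp [evolve, pureState, ContinuousLinearMap.adjoint_inner_right]

theorem hasSum_norm_inner_someBasis_sq (x : H) :
    HasSum (fun i => ‖⟪someBasis H i, x⟫_ℂ‖ ^ 2) (‖x‖ ^ 2) := by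
  have h := (someBasis H).hasSum_inner_mul_inner x x
  rw [inner_self_eq_norm_sq_to_K] at h
  have h' := Complex.hasSum_re h
  convert h' using 1
  · funext i
    rw [← inner_conj_symm x, Complex.conj_mul']
    norm_cast
  · norm_cast

theorem opPurity_pureState {ψ : H} (hψ : ‖ψ‖ = 1) : opPurity (pureState ψ) = 1 := by
  have h : pureState ψ ∘L pureState ψ = pureState ψ := isIdempotentElem_rankOne_self hψ
  have h' := (someBasis H).hasSum_inner_mul_inner ψ ψ
  rw [inner_self_eq_norm_sq_to_K, hψ] at h'
  rw [opPurity, h, opTrace]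
  simp only [pureState, rankOne_apply, inner_smul_right]
  rw [h'.tsum_eq]
  simp

/-- A mixture of pure states with total weight at most one has purity at most one. -/
theorem opPurity_le_one_of_hasSum_pureState {ι : Type*} {v : ι → H} {R : H →L[ℂ] H}
    (hR : HasSum (fun j => pureState (v j)) R)
    (hv : Summable fun j => ‖v j‖ ^ 2) (hv1 : ∑' j, ‖v j‖ ^ 2 ≤ 1) : opPurity R ≤ 1 := by
  have hsa : ContinuousLinearMap.adjoint R = R := by
    refine HasSum.unique (hR.star.congr_fun fun j => ?_) hR
    exact (adjoint_rankOne (v j) (v j)).symm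
  have hsq : ∀ e, Summable fun j => ‖⟪v j, e⟫_ℂ‖ ^ 2 := fun e => by
    refine Summable.of_nonneg_of_le (fun j => by positivity) (fun j => ?_) (hv.mul_right (‖e‖ ^ 2))
    rw [← mul_pow]
    gcongr
    exact norm_inner_le_norm _ _
  -- Cauchy–Schwarz on finite partial sums, where the total weight is at most one; then the limit.
  have hbound : ∀ e, ‖R e‖ ^ 2 ≤ ∑' j, ‖⟪v j, e⟫_ℂ‖ ^ 2 := fun e => by
    have hR' : HasSum (fun j => pureState (v j) e) (R e) :=
      hR.mapL (ContinuousLinearMap.apply ℂ H e)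
    have hlim : Tendsto (fun s => ‖∑ j ∈ s, pureState (v j) e‖ ^ 2) atTop (𝓝 (‖R e‖ ^ 2)) :=
      (Tendsto.norm hR').pow 2
    refine le_of_tendsto hlim (Eventually.of_forall fun s => ?_)
    calc ‖∑ j ∈ s, pureState (v j) e‖ ^ 2
        ≤ (∑ j ∈ s, ‖⟪v j, e⟫_ℂ‖ * ‖v j‖) ^ 2 := by
          gcongr
          refine (norm_sum_le _ _).trans_eq (Finset.sum_congr rfl fun j _ => ?_)
          rw [pureState, rankOne_apply, norm_smul]
      _ ≤ (∑ j ∈ s, ‖⟪v j, e⟫_ℂ‖ ^ 2) * ∑ j ∈ s, ‖v j‖ ^ 2 :=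
          Finset.sum_mul_sq_le_sq_mul_sq _ _ _
      _ ≤ (∑ j ∈ s, ‖⟪v j, e⟫_ℂ‖ ^ 2) * 1 := by
          gcongr
          exact (hv.sum_le_tsum s fun _ _ => by positivity).trans hv1
      _ ≤ ∑' j, ‖⟪v j, e⟫_ℂ‖ ^ 2 := by
          rw [mul_one]
          exact (hsq e).sum_le_tsum s fun _ _ => by positivity
  -- Since `R` is self-adjoint, its purity is its squared Hilbert–Schmidt norm.
  have htr : opPurity R = ∑' i, ‖R (someBasis H i)‖ ^ 2 := by
    have : ∀ i, ⟪someBasis H i, (R ∘L R) (someBasis H i)⟫_ℂ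
        = ((‖R (someBasis H i)‖ ^ 2 : ℝ) : ℂ) := fun i => by
      rw [ContinuousLinearMap.comp_apply, ← ContinuousLinearMap.adjoint_inner_left, hsa,
        inner_self_eq_norm_sq_to_K]
      norm_cast
    rw [opPurity, opTrace, tsum_congr this, ← Complex.ofReal_tsum, Complex.ofReal_re]
  rw [htr]
  refine Real.tsum_le_of_sum_le (fun i => by positivity) fun s => ?_
  calc ∑ i ∈ s, ‖R (someBasis H i)‖ ^ 2
      ≤ ∑ i ∈ s, ∑' j, ‖⟪v j, someBasis H i⟫_ℂ‖ ^ 2 := Finset.sum_le_sum fun i _ => hbound _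
    _ = ∑' j, ∑ i ∈ s, ‖⟪v j, someBasis H i⟫_ℂ‖ ^ 2 :=
        (Summable.tsum_finsetSum fun i _ => hsq _).symm
    _ ≤ ∑' j, ‖v j‖ ^ 2 := by
        refine (summable_sum fun i _ => hsq _).tsum_le_tsum (fun j => ?_) hv
        have h := (hasSum_norm_inner_someBasis_sq (v j))
        simp only [norm_inner_symm (someBasis H _)] at h
        exact sum_le_hasSum s (fun _ _ => by positivity) h
    _ ≤ 1 := hv1

/-- The identity holds term by term: each summand is the projector-like operator of one slice of
`Ψ`, so convergence plays no role. -/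
theorem partialTraceSnd_pureState (Ψ : HilbertTensor E F) :
    partialTraceSnd (pureState Ψ) =
      ∑' j, pureState (ContinuousLinearMap.adjoint (tensorWith E (someBasis F j)) Ψ) := by
  refine tsum_congr fun j => ?_
  ext x
  simp [pureState, ContinuousLinearMap.adjoint_inner_left]

/-- Bessel's inequality for the slices of a vector of the Hilbert tensor product. -/
theorem sum_norm_adjoint_tensorWith_sq_le (Ψ : HilbertTensor E F)
    (s : Finset (someBasisIndex F)) :
    ∑ j ∈ s, ‖ContinuousLinearMap.adjoint (tensorWith E (someBasis F j)) Ψ‖ ^ 2 ≤ ‖Ψ‖ ^ 2 := by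
  classical
  -- `w` below is the orthogonal projection of `Ψ` on the sum of the subspaces `E ⊗ f_j`, `j ∈ s`.
  set v := fun j => ContinuousLinearMap.adjoint (tensorWith E (someBasis F j)) Ψ with hv
  set w := ∑ j ∈ s, tensorWith E (someBasis F j) (v j) with hw
  have h1 : ⟪w, Ψ⟫_ℂ = ((∑ j ∈ s, ‖v j‖ ^ 2 : ℝ) : ℂ) := by
    rw [hw, sum_inner, Complex.ofReal_sum]
    refine Finset.sum_congr rfl fun j _ => ?_
    rw [← ContinuousLinearMap.adjoint_inner_right]
    change ⟪v j, v j⟫_ℂ = _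
    rw [inner_self_eq_norm_sq_to_K]
    norm_cast
  have h2 : ⟪w, w⟫_ℂ = ((∑ j ∈ s, ‖v j‖ ^ 2 : ℝ) : ℂ) := by
    rw [hw, sum_inner, Complex.ofReal_sum]
    refine Finset.sum_congr rfl fun j hj => ?_
    rw [inner_sum, Finset.sum_eq_single_of_mem j hj]
    · rw [tensorWith_apply, inner_productVector, inner_self_eq_norm_sq_to_K,
        inner_self_eq_norm_sq_to_K, (someBasis F).orthonormal.1]
      simp
    · intro k _ hk
      rw [tensorWith_apply, tensorWith_apply, inner_productVector,
        (someBasis F).orthonormal.2 hk.symm, mul_zero]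
  have h3 : ‖w‖ ^ 2 = ∑ j ∈ s, ‖v j‖ ^ 2 := by
    rw [inner_self_eq_norm_sq_to_K] at h2
    exact Complex.ofReal_injective ((Complex.ofReal_pow _ _).trans h2)
  have h4 : ∑ j ∈ s, ‖v j‖ ^ 2 ≤ ‖w‖ * ‖Ψ‖ := by
    have h := norm_inner_le_norm (𝕜 := ℂ) w Ψ
    rw [h1, Complex.norm_real] at h
    exact (le_abs_self _).trans h
  change ∑ j ∈ s, ‖v j‖ ^ 2 ≤ _
  nlinarith [sq_nonneg (‖w‖ - ‖Ψ‖)]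

theorem opPurity_partialTraceSnd_pureState_le_one {Ψ : HilbertTensor E F} (hΨ : ‖Ψ‖ = 1) :
    opPurity (partialTraceSnd (pureState Ψ)) ≤ 1 := by
  have h := sum_norm_adjoint_tensorWith_sq_le (E := E) (F := F) Ψ
  rw [hΨ, one_pow] at h
  rw [partialTraceSnd_pureState]
  have hv := summable_of_sum_le (fun _ => by positivity) h
  refine opPurity_le_one_of_hasSum_pureState (Summable.hasSum (Summable.of_norm ?_)) hv
    (Real.tsum_le_of_sum_le (fun _ => by positivity) h)
  simpa only [pureState, norm_rankOne, ← sq] using hv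

/-- Every slice is a multiple of `a`, and by Parseval the weights `|⟨f_j, b⟩|²` add up to one. -/
theorem partialTraceSnd_pureState_productVector (a : E) {b : F} (hb : ‖b‖ = 1) :
    partialTraceSnd (pureState (productVector a b)) = pureState a := by
  have h (j) : pureState (ContinuousLinearMap.adjoint (tensorWith E (someBasis F j))
      (productVector a b)) = (‖⟪someBasis F j, b⟫_ℂ‖ ^ 2) • pureState a := by
    have h' : ContinuousLinearMap.adjoint (tensorWith E (someBasis F j)) (productVector a b)
        = ⟪someBasis F j, b⟫_ℂ • a := by
      refine ext_inner_left ℂ fun e => ?_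
      rw [ContinuousLinearMap.adjoint_inner_right, tensorWith_apply, inner_productVector,
        inner_smul_right, mul_comm]
    ext x
    rw [h']
    simp only [pureState, rankOne_apply, inner_smul_left, smul_smul, smul_apply]
    rw [← Complex.coe_smul, smul_smul, mul_right_comm, Complex.conj_mul']
    push_cast
    rfl
  rw [partialTraceSnd_pureState, tsum_congr h]
  have hs := (hasSum_norm_inner_someBasis_sq b).smul_const (pureState a)
  rw [hs.tsum_eq, hb]
  simp

theorem opPurity_partialTraceSnd_of_pureState_eq_opTensor {Ψ : HilbertTensor E F} (hΨ : ‖Ψ‖ = 1)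
    {A : E →L[ℂ] E} {B : F →L[ℂ] F} (h : pureState Ψ = opTensor A B) :
    opPurity (partialTraceSnd (pureState Ψ)) = 1 := by
  obtain ⟨a, b, ha, hb, rfl⟩ := exists_productVector_of_pureState_eq_opTensor hΨ h
  rw [partialTraceSnd_pureState_productVector a hb, opPurity_pureState ha]

end Trace

/-- A function bounded above by `c` stays strictly below `c` in a punctured neighbourhood of any
point where its second derivative does not vanish. -/
theorem eventually_lt_of_deriv_deriv_ne_zero {p : ℝ → ℝ} {a c : ℝ} (hle : ∀ t, p t ≤ c)
    (h : deriv (deriv p) a ≠ 0) : ∀ᶠ t in 𝓝[≠] a, p t < c := by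
  -- Differentiability at `t` is not required: otherwise `deriv p t` is `0` by convention.
  have hmax (t : ℝ) (ht : p t = c) : deriv p t = 0 :=
    IsLocalMax.deriv_eq_zero (Eventually.of_forall fun s => (hle s).trans_eq ht.symm)
  -- By the same convention, a nonzero second derivative forces `deriv p` to be differentiable at
  -- `a`.
  have hd := (differentiableAt_of_deriv_ne_zero h).hasDerivAt
  filter_upwards [hd.eventually_ne h (c := 0)] with t ht
  exact lt_of_le_of_ne (hle t) fun htc => ht (hmax t htc)

theorem mainTheorem10 (d N : ℕ)
    (A_S : ℝ → Matrix (PhaseIdx d) (PhaseIdx d) ℝ)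
    (A_E : ℝ → Matrix (PhaseIdx N) (PhaseIdx N) ℝ)
    (G : ℝ → Matrix (PhaseIdx d) (PhaseIdx N) ℝ)
    (U : ℝ → HilbertTensor (L2 d) (L2 N) →L[ℂ] HilbertTensor (L2 d) (L2 N))
    (hU : IsPropagator (fun t => totalHamiltonian (A_S t) (A_E t) (G t)) U)
    (ρS₀ : L2 d →L[ℂ] L2 d) (ρE₀ : L2 N →L[ℂ] L2 N)
    (hS : IsGaussianPureState ρS₀) (hE : IsGaussianPureState ρE₀)
    (hp : deriv (deriv fun t =>
      opPurity (partialTraceSnd (evolve U (opTensor ρS₀ ρE₀) t))) 0 ≠ 0) :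
    ∃ ε : ℝ, 0 < ε ∧ ∀ t ∈ Set.Ioc 0 ε,
      evolve U (opTensor ρS₀ ρE₀) t ≠
        opTensor (partialTraceSnd (evolve U (opTensor ρS₀ ρE₀) t))
          (partialTraceFst (evolve U (opTensor ρS₀ ρE₀) t)) := by
  obtain ⟨ψ, hψ, rfl, -⟩ := hS
  obtain ⟨φ, hφ, rfl, -⟩ := hE
  simp only [opTensor_pureState, evolve_pureState] at hp ⊢
  have hnorm : ∀ t, ‖U t (productVector ψ φ)‖ = 1 := fun t => by
    rw [ContinuousLinearMap.norm_map_of_mem_unitary (hU.unitary t), norm_productVector, hψ, hφ,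
      one_mul]
  have hev := eventually_lt_of_deriv_deriv_ne_zero
    (fun t => opPurity_partialTraceSnd_pureState_le_one (hnorm t)) hp
  have hev' := (mem_nhdsGT_iff_exists_Ioc_subset).1
    (nhdsWithin_mono (0 : ℝ) (fun t ht => ne_of_gt ht) hev)
  obtain ⟨ε, hε, hsub⟩ := hev'
  exact ⟨ε, hε, fun t ht heq =>
    (hsub ht).ne (opPurity_partialTraceSnd_of_pureState_eq_opTensor (hnorm t) heq)⟩
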